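/- Let $M$ be a compact smooth manifold (for instance a compact Riemannian manifold). For $n\ge 1$ let $(P^{(n)}_t)_{t\ge0}$ be a Feller semigroup on $C(M^n)$, that is, a strongly continuous semigroup of positive linear operators with $P^{(n)}_0=\mathrm{Id}$ and $P^{(n)}_t1=1$. Suppose that the family $(P^{(n)}_t)_{n\ge1}$ is CDP, that is: * (compatible) whenever $1\le k<n$, $i_1,\dots,i_k\in\{1,\dots,n\}$ are distinct, and $f\in C(M^n)$, $\bar f\in C(M^k)$ satisfy $f(x_1,\dots,x_n)=\bar f(x_{i_1},\dots,x_{i_k})$, one has $P^{(n)}_tf(x_1,\dots,x_n)=P^{(k)}_t\bar f(x_{i_1},\dots,x_{i_k})$ for all $t\ge 0$ and all $x_1,\dots,x_n\in M$; * (diagonal preserving) $P^{(2)}_tf^{\otimes2}(x,x)=P^{(1)}_tf^2(x)$ for all $f\in C(M)$, $x\in M$ and $t\ge 0$. A submanifold of $M$ is the image $N=\iota(W)$ of a connected (Hausdorff, second countable) smooth manifold $W$ under an injective smooth immersion $\iota:W\to M$; it carries the intrinsic topology, transported from $W$. A Feller semigroup $P_t$ on $C(X)$ is degenerate along such an injected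 subspace $N\subset X$ if there is a Markovian semigroup $P^N_t$ on $N$ (a semigroup of Markov transition kernels on $N$ with the Borel $\sigma$-algebra of its intrinsic topology, with $P^N_0=\mathrm{Id}$) such that $P_tf(x)=P^N_t(f|_N)(x)$ for all $t\ge0$, $f\in C(X)$ and $x\in N$. The product $N^n\subset M^n$ carries the product of the intrinsic topologies. A foliation $\mathcal F$ of $M$ is given by a smooth atlas whose charts $\psi:U\to\mathbb R^d\times\mathbb R^q$, $d+q=\dim M$, have images $U_1\times U_2$ with $U_1,U_2$ open and $U_1$ connected, and whose changes of charts have the form $(x,y)\mapsto(h_1(x,y),h_2(y))$. Its leaves are the classes of points joined by finite chains of plaques $\psi^{-1}(U_1\times\{c\})$, with the intrinsic topology generated by the relatively open subsets of plaques. The leaves of the product foliation $\mathcal F^n$ of $M^n$ are the products $\mathcal L_1\times\dots\times\mathcal L_n$ of leaves of $\mathcal F$, with the product of the intrinsic topologies, and a Feller semigroup on $C(M^n)$ is $\mathcal F^n$-foliated if it is degenerate along every leaf of $\mathcal F^n$. 1. Let $N$ be a submanifold of $M$. If $P^{(k)}_t$ is $N^k$-degenerate for some $k\ge1$, then $P^{(n)}_t$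 is $N^n$-degenerate for every $n\ge1$. 2. Let $\mathcal F$ be a foliation of $M$. If $P^{(k)}_t$ is $\mathcal F^k$-foliated for some $k\ge1$, then $P^{(n)}_t$ is $\mathcal F^n$-foliated for every $n\ge1$. -/

import Mathlib

open Set Filter Topology MeasureTheory ProbabilityTheory
open scoped NNReal Manifold ContDiff

/-- A (conservative) Feller semigroup on `C(X)`, for a compact space `X`: a strongly continuous
semigroup of positive linear operators preserving the constant function `1`. -/
structure FellerSemigroup (X : Type*) [TopologicalSpace X] [CompactSpace X] where
  op : ℝ≥0 → C(X, ℝ) →L[ℝ] C(X, ℝ)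
  op_zero : op 0 = ContinuousLinearMap.id ℝ C(X, ℝ)
  op_add : ∀ s t, op (s + t) = (op s).comp (op t)
  op_nonneg : ∀ t f, 0 ≤ f → 0 ≤ op t f
  op_one : ∀ t, op t 1 = 1
  tendsto_op : ∀ f, Tendsto (fun t => op t f) (𝓝 0) (𝓝 f)

/-- A Markovian semigroup on a measurable space: a semigroup of Markov transition kernels, acting
on bounded measurable functions by `g ↦ (x ↦ ∫ g(y) κ_t(x, dy))`. -/
structure MarkovSemigroup (S : Type*) [MeasurableSpace S] where
  kernel : ℝ≥0 → Kernel S S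
  isMarkovKernel : ∀ t, IsMarkovKernel (kernel t)
  kernel_zero : kernel 0 = Kernel.id
  kernel_add : ∀ s t, kernel (s + t) = kernel s ∘ₖ kernel t

/-- A family of Feller semigroups, the `n`-th one on `C(M^n)`, is compatible and diagonal
preserving. The index `n = 0`, where `M^0` is a point, carries no information and is not used. -/
structure IsCDP {M : Type*} [TopologicalSpace M] [CompactSpace M]
    (P : ∀ n : ℕ, FellerSemigroup (Fin n → M)) : Prop where
  compatible : ∀ k n : ℕ, 1 ≤ k → k < n → ∀ i : Fin k → Fin n, Function.Injective i →
    ∀ (t : ℝ≥0) (f : C(Fin n → M, ℝ)) (g : C(Fin k → M, ℝ)),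
      (∀ x : Fin n → M, f x = g (fun j => x (i j))) →
      ∀ x : Fin n → M, (P n).op t f x = (P k).op t g (fun j => x (i j))
  diagonal : ∀ (t : ℝ≥0) (f : C(M, ℝ)) (x : M),
    (P 2).op t ⟨fun z => f (z 0) * f (z 1), by fun_prop⟩ (fun _ => x) =
      (P 1).op t ⟨fun z => f (z 0) ^ 2, by fun_prop⟩ (fun _ => x)

/-- The Feller semigroup `P` on `C(X)` is degenerate along the image `N = ι(W)` of an injective
map `ι : W → X`, where `N` carries the intrinsic topology, that of `W`: there is a Markovian
semigroup `Q` on the Borel space `W` such that `P_t f (x) = Q_t (f|_N) (x)` for all `f ∈ C(X)`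
and all `x ∈ N`. -/
def FellerSemigroup.IsDegenerate {X : Type*} [TopologicalSpace X] [CompactSpace X]
    (P : FellerSemigroup X) {W : Type*} [TopologicalSpace W] (ι : W → X) : Prop :=
  letI : MeasurableSpace W := borel W
  ∃ Q : MarkovSemigroup W, ∀ (t : ℝ≥0) (f : C(X, ℝ)) (w : W),
    P.op t f (ι w) = ∫ v, f (ι v) ∂(Q.kernel t w)

/-- A smooth regular foliation of an `m`-dimensional manifold with leaves of dimension `d` and
codimension `q`, given by a foliated atlas: the charts take values in `ℝ^d × ℝ^q`, their images
are products `U₁ × U₂` (with `U₁` connected, so that the plaques `U₁ × {c}` are connected), and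
the second component of a change of charts depends only on the second coordinate. -/
structure Foliation (m d q : ℕ) (M : Type*) [TopologicalSpace M]
    [ChartedSpace (EuclideanSpace ℝ (Fin m)) M] where
  charts : Set (OpenPartialHomeomorph M (EuclideanSpace ℝ (Fin d) × EuclideanSpace ℝ (Fin q)))
  dim_eq : d + q = m
  exists_mem_source : ∀ x : M, ∃ ψ ∈ charts, x ∈ ψ.source
  contMDiffOn : ∀ ψ ∈ charts,
    ContMDiffOn (𝓡 m) 𝓘(ℝ, EuclideanSpace ℝ (Fin d) × EuclideanSpace ℝ (Fin q)) ∞ ψ ψ.source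
  contMDiffOn_symm : ∀ ψ ∈ charts,
    ContMDiffOn 𝓘(ℝ, EuclideanSpace ℝ (Fin d) × EuclideanSpace ℝ (Fin q)) (𝓡 m) ∞
      ψ.symm ψ.target
  target_eq_prod : ∀ ψ ∈ charts, ∃ (U₁ : Set (EuclideanSpace ℝ (Fin d)))
    (U₂ : Set (EuclideanSpace ℝ (Fin q))),
    IsOpen U₁ ∧ IsPreconnected U₁ ∧ IsOpen U₂ ∧ ψ.target = U₁ ×ˢ U₂
  transition : ∀ ψ ∈ charts, ∀ φ ∈ charts,
    ∃ h₂ : EuclideanSpace ℝ (Fin q) → EuclideanSpace ℝ (Fin q),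
      ∀ z ∈ ψ.source ∩ φ.source, (φ z).2 = h₂ (ψ z).2

namespace Foliation

variable {m d q : ℕ} {M : Type*} [TopologicalSpace M] [ChartedSpace (EuclideanSpace ℝ (Fin m)) M]

/-- The plaque `ψ⁻¹(U₁ × {c})` of a foliated chart `ψ`. -/
def plaque (ψ : OpenPartialHomeomorph M (EuclideanSpace ℝ (Fin d) × EuclideanSpace ℝ (Fin q)))
    (c : EuclideanSpace ℝ (Fin q)) : Set M :=
  {z | z ∈ ψ.source ∧ (ψ z).2 = c}

/-- Two points lie in the same leaf if they are joined by a finite chain of plaques. -/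
def SameLeaf (F : Foliation m d q M) : M → M → Prop :=
  Relation.EqvGen fun x y => ∃ ψ ∈ F.charts, ∃ c, x ∈ plaque ψ c ∧ y ∈ plaque ψ c

/-- The leaf topology on `M`, whose basic open sets are the relatively open subsets of plaques. -/
abbrev leafTopology (F : Foliation m d q M) : TopologicalSpace M :=
  TopologicalSpace.generateFrom
    {s | ∃ ψ ∈ F.charts, ∃ c, ∃ O : Set M, IsOpen O ∧ s = O ∩ plaque ψ c}

/-- The leaf `𝓛_x` through `x`, as a space of its own. -/
def Leaf (F : Foliation m d q M) (x : M) : Type _ := {y : M // F.SameLeaf x y}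

/-- The inclusion of a leaf in `M`. -/
def Leaf.incl (F : Foliation m d q M) (x : M) (y : F.Leaf x) : M := y.1

/-- The intrinsic topology of a leaf. -/
instance (F : Foliation m d q M) (x : M) : TopologicalSpace (F.Leaf x) :=
  TopologicalSpace.induced (Leaf.incl F x) F.leafTopology

/-- `P` is foliated for the product foliation `𝓕^n` of `M^n`: it is degenerate along every leaf
`𝓛_{x_1} × ⋯ × 𝓛_{x_n}`, with the product of the intrinsic topologies. -/
def IsFoliatedPow [CompactSpace M] (F : Foliation m d q M) (n : ℕ)
    (P : FellerSemigroup (Fin n → M)) : Prop :=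
  ∀ x : Fin n → M,
    P.IsDegenerate (fun (y : ∀ j, F.Leaf (x j)) (j : Fin n) => Leaf.incl F (x j) (y j))

end Foliation

/-! Compatibility says that each coordinate of the n-point motion is a one-point motion
(`IsCDP.map_transition`). If the k-point motion keeps `N^k`, projecting to one coordinate shows that
the one-point motion started in `N` almost surely stays in `N`; then the n-point motion leaves `N^n`
with probability at most a sum of n zeros.

What remains is measurability: the transition kernels restrict to a Markovian semigroup on `N^n`
once the inclusion of `N` is a measurable embedding and `N` is second countable. A submanifold is
σ-compact, so closed sets have Fσ images. A leaf is a countable union of plaques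
(`exists_countable_plaques`), on each of which the leaf topology is the induced one. -/

/-- Two finite Borel measures on a compact metrizable space with the same integrals of continuous
functions are equal. -/
theorem MeasureTheory.Measure.ext_of_forall_integral_continuousMap {X : Type*} [TopologicalSpace X]
    [CompactSpace X] [TopologicalSpace.PseudoMetrizableSpace X] [MeasurableSpace X] [BorelSpace X]
    {μ ν : Measure X} [IsFiniteMeasure μ] [IsFiniteMeasure ν]
    (h : ∀ f : C(X, ℝ), ∫ x, f x ∂μ = ∫ x, f x ∂ν) : μ = ν :=
  ext_of_forall_integral_eq_of_IsFiniteMeasure fun f => h f.toContinuousMap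

/-- A family of probability measures on a compact metrizable space depends measurably on its
parameter if the integrals of continuous functions do. -/
theorem MeasureTheory.Measure.measurable_of_measurable_integral {X Y : Type*} [TopologicalSpace X]
    [CompactSpace X] [TopologicalSpace.PseudoMetrizableSpace X] [MeasurableSpace X] [BorelSpace X]
    [MeasurableSpace Y] {μ : Y → Measure X} [∀ y, IsProbabilityMeasure (μ y)]
    (h : ∀ f : C(X, ℝ), Measurable fun y => ∫ x, f x ∂(μ y)) : Measurable μ := by
  refine Measurable.measure_of_isPiSystem_of_isProbabilityMeasure
    (S := {s : Set X | IsClosed s}) ?_ isPiSystem_isClosed fun F hF => ?_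
  · rw [BorelSpace.measurable_eq (α := X), borel_eq_generateFrom_isClosed]
  · refine measurable_of_tendsto_metrizable
      (f := fun n y => ∫⁻ x, (IsClosed.apprSeq hF n x : ENNReal) ∂(μ y)) (fun n => ?_)
      (tendsto_pi_nhds.2 fun y => HasOuterApproxClosed.tendsto_lintegral_apprSeq hF (μ y))
    have key : ∀ y, ∫⁻ x, (IsClosed.apprSeq hF n x : ENNReal) ∂(μ y) =
        ENNReal.ofReal (∫ x, (IsClosed.apprSeq hF n x : ℝ) ∂(μ y)) := fun y => by
      rw [← BoundedContinuousFunction.toReal_lintegral_coe_eq_integral, ENNReal.ofReal_toReal]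
      exact (BoundedContinuousFunction.lintegral_lt_top_of_nnreal (μ y) _).ne
    simp only [key]
    exact (h ⟨fun x => (IsClosed.apprSeq hF n x : ℝ), by fun_prop⟩).ennreal_ofReal

/-! ### Transition kernels and their restriction to invariant sets. -/

namespace FellerSemigroup

variable {X : Type*} [TopologicalSpace X] [CompactSpace X] [T2Space X]
  [MeasurableSpace X] [BorelSpace X]

/-- Riesz–Markov–Kakutani for `f ↦ P_t f (x)`; total mass one comes from `P_t 1 = 1`. -/
theorem exists_measure (P : FellerSemigroup X) (t : ℝ≥0) (x : X) :
    ∃ μ : Measure X, IsProbabilityMeasure μ ∧ ∀ f : C(X, ℝ), ∫ y, f y ∂μ = P.op t f x := by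
  let Λ : CompactlySupportedContinuousMap X ℝ →ₚ[ℝ] ℝ := PositiveLinearMap.mk₀
    { toFun := fun f => P.op t f.toContinuousMap x
      map_add' := fun f g => by
        change P.op t (f.toContinuousMap + g.toContinuousMap) x = _
        simp
      map_smul' := fun c f => by
        change P.op t (c • f.toContinuousMap) x = _
        simp }
    (fun f hf => P.op_nonneg t f.toContinuousMap hf x)
  have key : ∀ f : C(X, ℝ), ∫ y, f y ∂(RealRMK.rieszMeasure Λ) = P.op t f x := fun f =>
    RealRMK.integral_rieszMeasure Λ (CompactlySupportedContinuousMap.continuousMapEquiv f)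
  refine ⟨RealRMK.rieszMeasure Λ, ⟨?_⟩, key⟩
  have h1 := key 1
  rw [P.op_one] at h1
  simpa [Measure.real, ENNReal.toReal_eq_one_iff] using h1

/-- The transition probabilities of a Feller semigroup. -/
noncomputable def transition (P : FellerSemigroup X) (t : ℝ≥0) (x : X) : Measure X :=
  (P.exists_measure t x).choose

instance (P : FellerSemigroup X) (t : ℝ≥0) (x : X) : IsProbabilityMeasure (P.transition t x) :=
  (P.exists_measure t x).choose_spec.1

theorem integral_transition (P : FellerSemigroup X) (t : ℝ≥0) (x : X) (f : C(X, ℝ)) :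
    ∫ y, f y ∂(P.transition t x) = P.op t f x :=
  (P.exists_measure t x).choose_spec.2 f

variable [TopologicalSpace.PseudoMetrizableSpace X]

theorem eq_transition (P : FellerSemigroup X) {t : ℝ≥0} {x : X} {μ : Measure X} [IsFiniteMeasure μ]
    (h : ∀ f : C(X, ℝ), ∫ y, f y ∂μ = P.op t f x) : μ = P.transition t x :=
  Measure.ext_of_forall_integral_continuousMap fun f => by rw [h, integral_transition]

theorem measurable_transition (P : FellerSemigroup X) (t : ℝ≥0) : Measurable (P.transition t) :=
  Measure.measurable_of_measurable_integral fun f => by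
    simp only [integral_transition]
    exact (P.op t f).continuous.measurable

/-- The Markovian semigroup of transition kernels of a Feller semigroup. -/
noncomputable def markovSemigroup (P : FellerSemigroup X) : MarkovSemigroup X where
  kernel t := ⟨P.transition t, P.measurable_transition t⟩
  isMarkovKernel t := ⟨fun x => inferInstanceAs (IsProbabilityMeasure (P.transition t x))⟩
  kernel_zero := by
    ext x : 1
    refine ((Kernel.id_apply x).trans (P.eq_transition fun f => ?_)).symm
    rw [integral_dirac, P.op_zero]
    rfl
  kernel_add s t := by
    have (r : ℝ≥0) : IsMarkovKernel (⟨P.transition r, P.measurable_transition r⟩ : Kernel X X) :=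
      ⟨fun x => inferInstanceAs (IsProbabilityMeasure (P.transition r x))⟩
    ext x : 1
    refine (P.eq_transition fun f => ?_).symm
    rw [Kernel.integral_comp]
    · change ∫ y, ∫ z, f z ∂(P.transition s y) ∂(P.transition t x) = _
      simp only [integral_transition]
      -- The iterated integral is `P_t (P_s f)`, in the order opposite to `op_add s t`.
      rw [add_comm, P.op_add]
      rfl
    · exact (BoundedContinuousFunction.mkOfCompact f).integrable _

end FellerSemigroup

/-- A Markovian semigroup which does not leave the image of a measurable embedding restricts to
it. -/
noncomputable def MarkovSemigroup.comap {X W : Type*} [MeasurableSpace X] [MeasurableSpace W]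
    (Q : MarkovSemigroup X) {e : W → X} (he : MeasurableEmbedding e)
    (h : ∀ t w, Q.kernel t (e w) (range e) = 1) : MarkovSemigroup W where
  kernel t := ((Q.kernel t).comap e he.measurable).comapRight he
  isMarkovKernel t := Kernel.IsMarkovKernel.comapRight _ he (h t)
  kernel_zero := by
    ext w s hs
    rw [Kernel.comapRight_apply' _ _ _ hs, Kernel.comap_apply, Q.kernel_zero, Kernel.id_apply,
      Kernel.id_apply, Measure.dirac_apply' _ hs,
      Measure.dirac_apply' _ (he.measurableSet_image.2 hs)]
    by_cases hw : w ∈ s <;> simp [hw, he.injective.mem_set_image]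
  kernel_add s t := by
    ext w A hA
    have hA' := he.measurableSet_image.2 hA
    -- No mass lies off `range e`, so pushing the restricted kernel forward recovers `Q`; this turns
    -- the Chapman–Kolmogorov integral over `X` into one over `W`.
    have hmap : (((Q.kernel t).comap e he.measurable).comapRight he w).map e =
        Q.kernel t (e w) := by
      have := Q.isMarkovKernel t
      rw [Kernel.comapRight_apply, he.map_comap, Kernel.comap_apply]
      refine Measure.restrict_eq_self_of_ae_mem ?_
      exact (prob_compl_eq_zero_iff he.measurableSet_range).2 (h t w)
    rw [Kernel.comapRight_apply' _ _ _ hA, Kernel.comap_apply, Q.kernel_add,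
      Kernel.comp_apply' _ _ _ hA', Kernel.comp_apply' _ _ _ hA, ← hmap,
      lintegral_map (Kernel.measurable_coe _ hA') he.measurable]
    simp [Kernel.comapRight_apply' _ _ _ hA]

namespace FellerSemigroup

variable {X : Type*} [TopologicalSpace X] [CompactSpace X] [T2Space X]
  [MeasurableSpace X] [BorelSpace X] [TopologicalSpace.PseudoMetrizableSpace X]

theorem isDegenerate_of_transition_range (P : FellerSemigroup X) {W : Type*} [TopologicalSpace W]
    [mW : MeasurableSpace W] [hW : BorelSpace W] {e : W → X} (he : MeasurableEmbedding e)
    (h : ∀ t w, P.transition t (e w) (range e) = 1) : P.IsDegenerate e := by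
  obtain rfl := hW.measurable_eq
  let : MeasurableSpace W := borel W
  refine ⟨P.markovSemigroup.comap he h, fun t f w => ?_⟩
  rw [← P.integral_transition]
  change _ = ∫ v, f (e v) ∂((P.transition t (e w)).comap e)
  rw [← he.integral_map, he.map_comap, Measure.restrict_eq_self_of_ae_mem]
  exact (prob_compl_eq_zero_iff he.measurableSet_range).2 (h t w)

end FellerSemigroup

/-! ### One-point marginals and products. -/

theorem IsCDP.op_eval {M : Type*} [TopologicalSpace M] [CompactSpace M]
    {P : ∀ n : ℕ, FellerSemigroup (Fin n → M)} (hP : IsCDP P) {n : ℕ} (j : Fin n) (t : ℝ≥0)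
    (g : C(Fin 1 → M, ℝ)) (x : Fin n → M) :
    (P n).op t ⟨fun y => g fun _ => y j, by fun_prop⟩ x = (P 1).op t g fun _ => x j := by
  obtain hn | hn := Nat.lt_or_ge 1 n
  -- Compatibility needs `k < n` strictly, hence the separate case `n = 1`.
  · exact hP.compatible 1 n le_rfl hn (fun _ => j) (Function.injective_of_subsingleton _) t _ g
      (fun _ => rfl) x
  · obtain rfl : n = 1 := by have := j.2; omega
    have hx : (fun _ => x j) = x := funext fun i => by rw [Subsingleton.elim i j]
    rw [hx]
    congr
    ext y
    exact congrArg g (funext fun i => by rw [Subsingleton.elim i j])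

section Power

variable {M : Type*} [TopologicalSpace M] [T2Space M] [CompactSpace M] [SecondCountableTopology M]
  [MeasurableSpace M] [BorelSpace M] {P : ∀ n : ℕ, FellerSemigroup (Fin n → M)}

theorem IsCDP.map_transition (hP : IsCDP P) {n : ℕ} (j : Fin n) (t : ℝ≥0) (x : Fin n → M) :
    ((P n).transition t x).map (fun y (_ : Fin 1) => y j) =
      (P 1).transition t fun _ => x j := by
  have hm : Measurable fun (y : Fin n → M) (_ : Fin 1) => y j := by fun_prop
  have := Measure.isProbabilityMeasure_map (μ := (P n).transition t x) hm.aemeasurable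
  refine (P 1).eq_transition fun g => ?_
  rw [integral_map hm.aemeasurable g.continuous.aestronglyMeasurable, ← hP.op_eval j,
    ← FellerSemigroup.integral_transition]
  rfl

theorem MeasurableEmbedding.piMap {ι : Type*} [Countable ι] {X Y : ι → Type*}
    [∀ i, MeasurableSpace (X i)] [∀ i, MeasurableSpace (Y i)] {e : ∀ i, X i → Y i}
    (he : ∀ i, MeasurableEmbedding (e i)) :
    MeasurableEmbedding fun (x : ∀ i, X i) i => e i (x i) := by
  have hr : range (fun (x : ∀ i, X i) i => e i (x i)) = univ.pi fun i => range (e i) :=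
    range_piMap e
  refine MeasurableEmbedding.iff_comap_eq.2 ⟨fun x y h => funext fun i =>
    (he i).injective (congrFun h i), ?_, ?_⟩
  · simp only [MeasurableSpace.pi, MeasurableSpace.comap_iSup, MeasurableSpace.comap_comp,
      Function.comp_def]
    refine iSup_congr fun i => ?_
    rw [← (he i).comap_eq, MeasurableSpace.comap_comp]
    rfl
  · rw [hr]
    exact MeasurableSet.univ_pi fun i => (he i).measurableSet_range

/-- If the one-point motion started in `e(W)` stays in `e(W)`, the `n`-point motion started in a
product of such images stays there. -/
theorem IsCDP.isDegenerate_pi (hP : IsCDP P) {n : ℕ} {W : Fin n → Type*}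
    [∀ j, TopologicalSpace (W j)] [∀ j, SecondCountableTopology (W j)]
    [∀ j, MeasurableSpace (W j)] [∀ j, BorelSpace (W j)] {e : ∀ j, W j → M}
    (he : ∀ j, MeasurableEmbedding (e j))
    (h : ∀ j t w, (P 1).transition t (fun _ => e j w) {z | z 0 ∈ range (e j)} = 1) :
    (P n).IsDegenerate fun (w : ∀ j, W j) j => e j (w j) := by
  have hE := MeasurableEmbedding.piMap he
  refine (P n).isDegenerate_of_transition_range hE fun t w => ?_
  rw [← prob_compl_eq_zero_iff hE.measurableSet_range]
  have hsub : (range fun (w : ∀ j, W j) j => e j (w j))ᶜ ⊆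
      ⋃ j, {y : Fin n → M | y j ∉ range (e j)} := by
    intro y hy
    by_contra hcon
    simp only [mem_iUnion, mem_ofPred_eq, not_exists, not_not] at hcon
    choose v hv using hcon
    exact hy ⟨v, funext hv⟩
  refine measure_mono_null hsub (measure_iUnion_null fun j => ?_)
  have hm : MeasurableSet {z : Fin 1 → M | z 0 ∈ range (e j)} :=
    measurable_pi_apply 0 (he j).measurableSet_range
  have hj := (prob_compl_eq_zero_iff hm).2 (h j t (w j))
  rw [← hP.map_transition j t fun j => e j (w j), Measure.map_apply (by fun_prop) hm.compl] at hj
  exact hj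

/-- Start all `k` points at `e w`: the law of the k-point motion is the image of a measure on `W^k`,
so its coordinate `0` lies in `range e`. -/
theorem IsCDP.transition_range_of_isDegenerate (hP : IsCDP P) {k : ℕ} (hk : 1 ≤ k) {W : Type*}
    [TopologicalSpace W] [SecondCountableTopology W]
    [mW : MeasurableSpace W] [hW : BorelSpace W] {e : W → M} (he : MeasurableEmbedding e)
    (h : (P k).IsDegenerate fun (w : Fin k → W) j => e (w j)) (t : ℝ≥0) (w : W) :
    (P 1).transition t (fun _ => e w) {z | z 0 ∈ range e} = 1 := by
  have hk0 : 0 < k := hk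
  -- Second countability identifies the Borel σ-algebra of the product with the product σ-algebra.
  have hpi : borel (Fin k → W) = MeasurableSpace.pi := (Pi.borelSpace.measurable_eq).symm
  unfold FellerSemigroup.IsDegenerate at h
  rw [hpi] at h
  obtain ⟨Q, hQ⟩ := h
  have := Q.isMarkovKernel t
  have hE : Measurable fun (v : Fin k → W) j => e (v j) :=
    (MeasurableEmbedding.piMap fun _ => he).measurable
  have hm : MeasurableSet {z : Fin 1 → M | z 0 ∈ range e} :=
    measurable_pi_apply 0 he.measurableSet_range
  have hev : Measurable fun (y : Fin k → M) (_ : Fin 1) => y ⟨0, hk0⟩ := by fun_prop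
  have hmap := Measure.isProbabilityMeasure_map (μ := Q.kernel t fun _ => w) hE.aemeasurable
  have key : (Q.kernel t fun _ => w).map (fun v j => e (v j)) =
      (P k).transition t fun _ => e w :=
    (P k).eq_transition fun f => by
      rw [integral_map hE.aemeasurable f.continuous.aestronglyMeasurable]
      exact (hQ t f fun _ => w).symm
  rw [← hP.map_transition ⟨0, hk0⟩ t fun _ => e w, Measure.map_apply hev hm, ← key,
    Measure.map_apply hE (hev hm)]
  convert measure_univ (μ := Q.kernel t fun _ => w)
  exact eq_univ_of_forall fun v => mem_range_self _

end Power

/-! ### Criteria for measurable embeddings. -/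

theorem MeasurableEmbedding.of_generateFrom {W X : Type*} [mW : MeasurableSpace W]
    [MeasurableSpace X] {e : W → X} {C : Set (Set W)} (hC : mW = MeasurableSpace.generateFrom C)
    (hinj : Function.Injective e) (he : Measurable e) (hrange : MeasurableSet (range e))
    (h : ∀ s ∈ C, MeasurableSet (e '' s)) : MeasurableEmbedding e := by
  refine ⟨hinj, he, fun s hs => ?_⟩
  rw [hC] at hs
  induction s, hs using MeasurableSpace.generateFrom_induction with
  | hC s hs => exact h s hs
  | empty => simp
  | compl s _ ih =>
    rw [compl_eq_univ_sdiff, image_sdiff hinj, image_univ]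
    exact hrange.diff ih
  | iUnion s _ ih =>
    rw [image_iUnion]
    exact MeasurableSet.iUnion ih

/-- An injective continuous map from a σ-compact space to a Hausdorff space is a measurable
embedding. -/
theorem Continuous.measurableEmbedding_of_sigmaCompact {W X : Type*} [TopologicalSpace W]
    [SigmaCompactSpace W] [MeasurableSpace W] [BorelSpace W] [TopologicalSpace X] [T2Space X]
    [MeasurableSpace X] [BorelSpace X] {e : W → X} (he : Continuous e)
    (hinj : Function.Injective e) : MeasurableEmbedding e := by
  have hclosed : ∀ s : Set W, IsClosed s → MeasurableSet (e '' s) := fun s hs => by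
    have hs' : s = ⋃ n, s ∩ compactCovering W n := by
      rw [← inter_iUnion, iUnion_compactCovering, inter_univ]
    rw [hs', image_iUnion]
    exact MeasurableSet.iUnion fun n =>
      (((isCompact_compactCovering W n).inter_left hs).image he).isClosed.measurableSet
  exact .of_generateFrom (BorelSpace.measurable_eq.trans borel_eq_generateFrom_isClosed) hinj
    he.measurable (image_univ ▸ hclosed univ isClosed_univ) hclosed

/-! ### Plaques and the intrinsic topology of leaves. -/

namespace Foliation

variable {m d q : ℕ} {M : Type*} [TopologicalSpace M] [ChartedSpace (EuclideanSpace ℝ (Fin m)) M]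
  {ψ φ : OpenPartialHomeomorph M (EuclideanSpace ℝ (Fin d) × EuclideanSpace ℝ (Fin q))}
  {c c' : EuclideanSpace ℝ (Fin q)}

/-- A plaque meets at most one plaque of any other chart. -/
theorem mem_plaque_of_mem (F : Foliation m d q M) (hψ : ψ ∈ F.charts) (hφ : φ ∈ F.charts) {y z : M}
    (hy : y ∈ plaque ψ c) (hyφ : y ∈ plaque φ c') (hz : z ∈ plaque ψ c) (hzφ : z ∈ φ.source) :
    z ∈ plaque φ c' := by
  obtain ⟨h, hh⟩ := F.transition ψ hψ φ hφ
  refine ⟨hzφ, ?_⟩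
  rw [hh z ⟨hz.1, hzφ⟩, hz.2, ← hy.2, ← hh y ⟨hy.1, hyφ.1⟩, hyφ.2]

theorem isPreconnected_plaque (F : Foliation m d q M) (hψ : ψ ∈ F.charts)
    (c : EuclideanSpace ℝ (Fin q)) : IsPreconnected (plaque ψ c) := by
  obtain ⟨U₁, U₂, -, hU₁, -, hU⟩ := F.target_eq_prod ψ hψ
  by_cases hc : c ∈ U₂
  · have hsub : U₁ ×ˢ {c} ⊆ ψ.target := by
      rw [hU]
      exact prod_mono_right (singleton_subset_iff.2 hc)
    have heq : plaque ψ c = ψ.symm '' (U₁ ×ˢ {c}) := by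
      ext z
      constructor
      · rintro ⟨hz, hzc⟩
        have hmem : ψ z ∈ U₁ ×ˢ U₂ := hU ▸ ψ.map_source hz
        exact ⟨ψ z, ⟨hmem.1, hzc⟩, ψ.left_inv hz⟩
      · rintro ⟨p, hp, rfl⟩
        exact ⟨ψ.map_target (hsub hp), by rw [ψ.right_inv (hsub hp)]; exact hp.2⟩
    rw [heq]
    exact (hU₁.prod isPreconnected_singleton).image _ (ψ.continuousOn_symm.mono hsub)
  · convert isPreconnected_empty
    refine eq_empty_of_forall_notMem fun z hz => hc ?_
    have hmem : ψ z ∈ U₁ ×ˢ U₂ := hU ▸ ψ.map_source hz.1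
    exact hz.2 ▸ hmem.2

theorem measurableSet_plaque [MeasurableSpace M] [BorelSpace M]
    (ψ : OpenPartialHomeomorph M (EuclideanSpace ℝ (Fin d) × EuclideanSpace ℝ (Fin q)))
    (c : EuclideanSpace ℝ (Fin q)) : MeasurableSet (plaque ψ c) := by
  have hO : IsOpen (ψ.source ∩ ψ ⁻¹' {p | p.2 ≠ c}) :=
    ψ.isOpen_inter_preimage (isOpen_ne_fun continuous_snd continuous_const)
  have heq : plaque ψ c = ψ.source \ (ψ.source ∩ ψ ⁻¹' {p | p.2 ≠ c}) := by
    ext z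
    simp only [plaque, Set.mem_sdiff, mem_inter_iff, mem_preimage, mem_ofPred_eq]
    tauto
  rw [heq]
  exact ψ.open_source.measurableSet.diff hO.measurableSet

/-- On a plaque, the leaf topology is the topology induced by `M`. -/
theorem exists_isOpen_inter_plaque_eq (F : Foliation m d q M) (hψ : ψ ∈ F.charts)
    (c : EuclideanSpace ℝ (Fin q)) {s : Set M} (hs : IsOpen[F.leafTopology] s) :
    ∃ O : Set M, IsOpen O ∧ s ∩ plaque ψ c = O ∩ plaque ψ c := by
  induction hs with
  | basic s hs =>
    obtain ⟨φ, hφ, c', O, hO, rfl⟩ := hs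
    by_cases hne : (plaque ψ c ∩ plaque φ c').Nonempty
    · obtain ⟨y, hy, hy'⟩ := hne
      refine ⟨O ∩ φ.source, hO.inter φ.open_source, ?_⟩
      ext z
      exact ⟨fun hz => ⟨⟨hz.1.1, hz.1.2.1⟩, hz.2⟩, fun hz =>
        ⟨⟨hz.1.1, F.mem_plaque_of_mem hψ hφ hy hy' hz.2 hz.1.2⟩, hz.2⟩⟩
    · refine ⟨∅, isOpen_empty, ?_⟩
      rw [empty_inter]
      exact eq_empty_of_forall_notMem fun z hz => hne ⟨z, hz.2, hz.1.2⟩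
  | univ => exact ⟨univ, isOpen_univ, rfl⟩
  | inter s t _ _ ihs iht =>
    obtain ⟨O, hO, hsO⟩ := ihs
    obtain ⟨O', hO', htO⟩ := iht
    refine ⟨O ∩ O', hO.inter hO', ?_⟩
    rw [inter_inter_distrib_right, hsO, htO, ← inter_inter_distrib_right]
  | sUnion S _ ih =>
    choose! O hO hSO using ih
    refine ⟨⋃ s ∈ S, O s, isOpen_biUnion hO, ?_⟩
    rw [sUnion_eq_biUnion, iUnion₂_inter, iUnion₂_inter]
    exact iUnion₂_congr hSO

theorem isOpen_leafTopology_plaque (F : Foliation m d q M) (hψ : ψ ∈ F.charts)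
    (c : EuclideanSpace ℝ (Fin q)) : IsOpen[F.leafTopology] (plaque ψ c) :=
  TopologicalSpace.isOpen_generateFrom_of_mem ⟨ψ, hψ, c, univ, isOpen_univ, (univ_inter _).symm⟩

theorem isOpen_leafTopology_of_isOpen (F : Foliation m d q M) {O : Set M} (hO : IsOpen O) :
    IsOpen[F.leafTopology] O := by
  choose ψ hψ hx using F.exists_mem_source
  have heq : O = ⋃ x, O ∩ plaque (ψ x) (ψ x x).2 :=
    Subset.antisymm (fun x hxO => mem_iUnion.2 ⟨x, hxO, hx x, rfl⟩)
      (iUnion_subset fun x => inter_subset_left)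
  rw [heq]
  exact @isOpen_iUnion _ _ F.leafTopology _ fun x =>
    TopologicalSpace.isOpen_generateFrom_of_mem ⟨ψ x, hψ x, _, O, hO, rfl⟩

theorem Leaf.isOpen_iff (F : Foliation m d q M) {x : M} {A : Set (F.Leaf x)} :
    IsOpen A ↔ ∃ A' : Set M, IsOpen[F.leafTopology] A' ∧ Leaf.incl F x ⁻¹' A' = A :=
  Iff.rfl

theorem Leaf.continuous_incl (F : Foliation m d q M) (x : M) : Continuous (Leaf.incl F x) :=
  continuous_def.2 fun O hO =>
    (Leaf.isOpen_iff F).2 ⟨O, F.isOpen_leafTopology_of_isOpen hO, rfl⟩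

theorem SameLeaf.of_plaque (F : Foliation m d q M) (hψ : ψ ∈ F.charts) {x y z : M}
    (hxy : F.SameLeaf x y) (hy : y ∈ plaque ψ c) (hz : z ∈ plaque ψ c) : F.SameLeaf x z :=
  hxy.trans _ _ _ (.rel _ _ ⟨ψ, hψ, c, hy, hz⟩)

/-- A leaf of a foliation of a compact manifold is covered by countably many plaques. -/
theorem exists_countable_plaques [CompactSpace M] (F : Foliation m d q M) (x : M) :
    ∃ S : Set (Set M), S.Countable ∧ (∀ s ∈ S, ∃ ψ ∈ F.charts, ∃ c, s = plaque ψ c) ∧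
      ∀ y, F.SameLeaf x y → ∃ s ∈ S, y ∈ s := by
  choose ψ hψ hmem using F.exists_mem_source
  obtain ⟨t, ht⟩ := CompactSpace.elim_nhds_subcover (fun y => (ψ y).source)
    fun y => (ψ y).open_source.mem_nhds (hmem y)
  have hcov : ∀ y, ∃ j : t, y ∈ (ψ j).source := fun y => by
    have hy : y ∈ ⋃ z ∈ t, (ψ z).source := ht ▸ mem_univ y
    simp only [mem_iUnion] at hy
    obtain ⟨j, hj, hy⟩ := hy
    exact ⟨⟨j, hj⟩, hy⟩
  choose h hh using fun i j : t => F.transition (ψ i) (hψ i) (ψ j) (hψ j)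
  obtain ⟨i₀, hi₀⟩ := hcov x
  -- A word in the finite cover `t` encodes a chain of plaques, each label carried on by the
  -- transition maps, so there are countably many. A word whose plaques do not meet may give a
  -- plaque off the leaf; this is harmless, as only covering matters.
  let p : List t → t × EuclideanSpace ℝ (Fin q) :=
    List.foldr (fun j ic => (j, h ic.1 j ic.2)) (i₀, (ψ i₀ x).2)
  let B : Set M := {y | ∃ l, y ∈ plaque (ψ (p l).1) (p l).2}
  have hB : ∀ (j : t) (y : M), y ∈ B → y ∈ (ψ j).source →
      ∃ l, (p l).1 = j ∧ (p l).2 = (ψ j y).2 := fun j y ⟨l, hl⟩ hyj =>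
    ⟨j :: l, rfl, by rw [hh (p l).1 j y ⟨hl.1, hyj⟩, hl.2]; rfl⟩
  have hlocal : ∀ (φ) (_ : φ ∈ F.charts) (c) (j : t) (y z : M), y ∈ plaque φ c → z ∈ plaque φ c →
      y ∈ (ψ j).source → z ∈ (ψ j).source → y ∈ B → z ∈ B := by
    intro φ hφ c j y z hy hz hyj hzj hyB
    obtain ⟨l, rfl, hl⟩ := hB j y hyB hyj
    exact ⟨l, F.mem_plaque_of_mem hφ (hψ _) hy ⟨hyj, hl.symm⟩ hz hzj⟩
  have hsat : ∀ (φ) (_ : φ ∈ F.charts) (c) (y z : M), y ∈ plaque φ c → z ∈ plaque φ c →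
      y ∈ B → z ∈ B := by
    intro φ hφ c y z hy hz hyB
    by_contra hzB
    -- `U B` and `U Bᶜ` are open and cover the connected plaque. By `hlocal`, a point of the plaque
    -- common to both would carry membership in `B` over to a point of `Bᶜ`.
    let U (A : Set M) : Set M :=
      ⋃ (j : t) (_ : ((plaque φ c ∩ A) ∩ (ψ j).source).Nonempty), (ψ j).source
    have hUo (A : Set M) : IsOpen (U A) :=
      isOpen_iUnion fun j => isOpen_iUnion fun _ => (ψ j).open_source
    have hU (A : Set M) (w : M) (hw : w ∈ plaque φ c) (hwA : w ∈ A) : w ∈ U A := by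
      obtain ⟨j, hj⟩ := hcov w
      exact mem_iUnion₂.2 ⟨j, ⟨w, ⟨hw, hwA⟩, hj⟩, hj⟩
    obtain ⟨w, hw, hw₁, hw₂⟩ := F.isPreconnected_plaque hφ c (U B) (U Bᶜ) (hUo _) (hUo _)
      (fun w hw => (em (w ∈ B)).imp (hU B w hw) (hU Bᶜ w hw))
      ⟨y, hy, hU B y hy hyB⟩ ⟨z, hz, hU Bᶜ z hz hzB⟩
    obtain ⟨j, ⟨y', ⟨hy', hyB'⟩, hyj⟩, hwj⟩ := mem_iUnion₂.1 hw₁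
    obtain ⟨j', ⟨z', ⟨hz', hzB'⟩, hzj⟩, hwj'⟩ := mem_iUnion₂.1 hw₂
    exact hzB' (hlocal φ hφ c j' w z' hw hz' hwj' hzj (hlocal φ hφ c j y' w hy' hw hyj hwj hyB'))
  have hleaf : ∀ y z, F.SameLeaf y z → (y ∈ B ↔ z ∈ B) := by
    intro y z hyz
    induction hyz with
    | rel y z hyz =>
      obtain ⟨φ, hφ, c, hy, hz⟩ := hyz
      exact ⟨hsat φ hφ c y z hy hz, hsat φ hφ c z y hz hy⟩
    | refl => rfl
    | symm _ _ _ ih => exact ih.symm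
    | trans _ _ _ _ _ ih ih' => exact ih.trans ih'
  refine ⟨range fun l => plaque (ψ (p l).1) (p l).2, countable_range _, ?_, fun y hy => ?_⟩
  · rintro _ ⟨l, rfl⟩
    exact ⟨_, hψ _, _, rfl⟩
  · obtain ⟨l, hl⟩ := (hleaf x y hy).1 ⟨[], hi₀, rfl⟩
    exact ⟨_, ⟨l, rfl⟩, hl⟩

theorem Leaf.secondCountableTopology [CompactSpace M] [SecondCountableTopology M]
    (F : Foliation m d q M) (x : M) : SecondCountableTopology (F.Leaf x) := by
  obtain ⟨S, hS, hplaque, hcov⟩ := F.exists_countable_plaques x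
  have := hS.to_subtype
  have hsc (s : S) : SecondCountableTopology (Leaf.incl F x ⁻¹' (s : Set M)) := by
    obtain ⟨ψ, hψ, c, hs⟩ := hplaque s s.2
    have hind : IsInducing fun y : Leaf.incl F x ⁻¹' (s : Set M) => Leaf.incl F x y := by
      refine ⟨le_antisymm
        ((Leaf.continuous_incl F x).comp continuous_subtype_val).le_induced fun A hA => ?_⟩
      obtain ⟨A', hA', rfl⟩ := isOpen_induced_iff.1 hA
      obtain ⟨A'', hA'', rfl⟩ := (Leaf.isOpen_iff F).1 hA'
      obtain ⟨O, hO, hAO⟩ := F.exists_isOpen_inter_plaque_eq hψ c hA''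
      refine isOpen_induced_iff.2 ⟨O, hO, ?_⟩
      ext y
      have hy : Leaf.incl F x y ∈ plaque ψ c := hs ▸ y.2
      have := Set.ext_iff.1 hAO (Leaf.incl F x y)
      simp only [mem_inter_iff, hy, and_true] at this
      exact this.symm
    exact hind.secondCountableTopology
  refine TopologicalSpace.secondCountableTopology_of_countable_cover
    (U := fun s : S => Leaf.incl F x ⁻¹' (s : Set M)) (fun s => ?_) ?_
  · obtain ⟨ψ, hψ, c, hs⟩ := hplaque s s.2
    exact (Leaf.isOpen_iff F).2 ⟨s, hs ▸ F.isOpen_leafTopology_plaque hψ c, rfl⟩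
  · refine eq_univ_of_forall fun y => ?_
    obtain ⟨s, hs, hy⟩ := hcov y.1 y.2
    exact mem_iUnion.2 ⟨⟨s, hs⟩, hy⟩

theorem Leaf.measurableEmbedding_incl [CompactSpace M] [MeasurableSpace M] [BorelSpace M]
    (F : Foliation m d q M) (x : M) [MeasurableSpace (F.Leaf x)] [BorelSpace (F.Leaf x)] :
    MeasurableEmbedding (Leaf.incl F x) := by
  obtain ⟨S, hS, hplaque, hcov⟩ := F.exists_countable_plaques x
  have hinj : Function.Injective (Leaf.incl F x) := Subtype.val_injective
  have hopen : ∀ A : Set (F.Leaf x), IsOpen A → MeasurableSet (Leaf.incl F x '' A) := by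
    intro A hA
    obtain ⟨A', hA', rfl⟩ := (Leaf.isOpen_iff F).1 hA
    have heq : Leaf.incl F x '' (Leaf.incl F x ⁻¹' A') =
        ⋃ s ∈ S, (A' ∩ s) ∩ {y | F.SameLeaf x y} := by
      ext y
      simp only [mem_iUnion]
      constructor
      · rintro ⟨y, hy, rfl⟩
        obtain ⟨s, hs, hys⟩ := hcov y.1 y.2
        exact ⟨s, hs, ⟨hy, hys⟩, y.2⟩
      · rintro ⟨s, hs, ⟨hy, -⟩, hyx⟩
        exact ⟨⟨y, hyx⟩, hy, rfl⟩
    rw [heq]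
    refine MeasurableSet.biUnion hS fun s hs => ?_
    obtain ⟨ψ, hψ, c, rfl⟩ := hplaque s hs
    obtain ⟨O, hO, hAO⟩ := F.exists_isOpen_inter_plaque_eq hψ c hA'
    rw [hAO]
    -- A plaque is either inside the leaf or disjoint from it, so measurability of the leaf itself
    -- is not presupposed.
    by_cases hne : ∃ y ∈ plaque ψ c, F.SameLeaf x y
    · obtain ⟨y, hy, hxy⟩ := hne
      have hsub : O ∩ plaque ψ c ⊆ {y | F.SameLeaf x y} := fun z hz =>
        SameLeaf.of_plaque F hψ hxy hy hz.2
      rw [inter_eq_left.2 hsub]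
      exact hO.measurableSet.inter (measurableSet_plaque ψ c)
    · convert MeasurableSet.empty
      exact eq_empty_of_forall_notMem fun z hz => hne ⟨z, hz.1.2, hz.2⟩
  exact .of_generateFrom BorelSpace.measurable_eq hinj
    (Leaf.continuous_incl F x).measurable (image_univ ▸ hopen univ isOpen_univ) hopen

end Foliation

/-! ### The two statements. -/

theorem corollary3 {m : ℕ} {M : Type*} [TopologicalSpace M] [T2Space M] [CompactSpace M]
    [ChartedSpace (EuclideanSpace ℝ (Fin m)) M] [IsManifold (𝓡 m) ∞ M]
    (P : ∀ n : ℕ, FellerSemigroup (Fin n → M)) (hP : IsCDP P) :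
    (∀ (d : ℕ) (W : Type*) [TopologicalSpace W] [T2Space W] [SecondCountableTopology W]
      [ConnectedSpace W] [ChartedSpace (EuclideanSpace ℝ (Fin d)) W] [IsManifold (𝓡 d) ∞ W]
      (ι : W → M), Manifold.IsImmersion (𝓡 d) (𝓡 m) ∞ ι → Function.Injective ι →
      ∀ k : ℕ, 1 ≤ k →
        (P k).IsDegenerate (fun (w : Fin k → W) (j : Fin k) => ι (w j)) →
        ∀ n : ℕ, 1 ≤ n →
          (P n).IsDegenerate (fun (w : Fin n → W) (j : Fin n) => ι (w j))) ∧
    (∀ (d q : ℕ) (F : Foliation m d q M),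
      ∀ k : ℕ, 1 ≤ k → F.IsFoliatedPow k (P k) →
        ∀ n : ℕ, 1 ≤ n → F.IsFoliatedPow n (P n)) := by
  have := ChartedSpace.secondCountable_of_sigmaCompact (EuclideanSpace ℝ (Fin m)) M
  borelize M
  refine ⟨?_, ?_⟩
  · intro d W _ _ _ _ _ _ ι hι hinj k hk hdeg n _
    borelize W
    -- Local compactness and second countability make `W` σ-compact.
    have := ChartedSpace.locallyCompactSpace (EuclideanSpace ℝ (Fin d)) W
    have he : MeasurableEmbedding ι :=
      hι.contMDiff.continuous.measurableEmbedding_of_sigmaCompact hinj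
    exact hP.isDegenerate_pi (fun _ => he) fun _ t w =>
      hP.transition_range_of_isDegenerate hk he hdeg t w
  · intro d q F k hk hdeg n _ x
    let (y : M) : MeasurableSpace (F.Leaf y) := borel _
    have (y : M) : BorelSpace (F.Leaf y) := ⟨rfl⟩
    have (y : M) := Foliation.Leaf.secondCountableTopology F y
    have he (y : M) := Foliation.Leaf.measurableEmbedding_incl F y
    -- The factors may be different leaves; for each, the hypothesis is applied to the k-th power of
    -- that single leaf.
    exact hP.isDegenerate_pi (fun j => he (x j)) fun j t w =>
      hP.transition_range_of_isDegenerate hk (he (x j)) (hdeg fun _ => x j) t w
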